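/- **Theorem 4.6.** A *compact line* is a totally ordered space that is compact in its order topology. For a compact line $K$: - $\mathrm{NBV}(K)$ is the set of right-continuous maps $F:K\to\mathbb R$ of bounded variation. A finite regular signed Borel measure $\mu$ on $K$ corresponds to $F\in\mathrm{NBV}(K)$ if $F(t)=\mu([\min K,t])$ for all $t\in K$. A family $(F_i)_{i\in I}$ in $\mathrm{NBV}(K)$ is *weak\*-null* if the corresponding measures $\mu_i$ satisfy $\big(\int_K f\,d\mu_i\big)_{i\in I}\in c_0(I)$ for every $f\in C(K)$. Here $(x_i)_{i\in I}\in c_0(I)$ means that $\{i\in I:|x_i|\ge\varepsilon\}$ is finite for every $\varepsilon>0$. - A family $(F_i)_{i\in I}$ of real-valued maps is *of type $c_0\ell_1$ over a set $Q$* if there are real numbers $a_{i,t},b_{i,t}$ ($i\in I$, $t\in Q$) with $F_i(t)=a_{i,t}+b_{i,t}$, $(a_{i,t})_{i\in I}\in c_0(I)$ for every $t\in Q$, and $\sup_{i\in I}\sum_{t\in Q}|b_{i,t}|<+\infty$. - For $H\subset K$, $H^+$ is the set of those $t\in H$ such that $t=\max H$ or there is $s\in H$ with $s>t$ and $H\cap\,]t,s[\,=\emptyset$.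 - $K$ is *separably determined* if, for every weak\*-null family $(F_i)_{i\in I}$ in $\mathrm{NBV}(K)$ and every $Q\subset K$, the following holds: if $\{t\in Q\cap(H\setminus H^+):(F_i(t))_{i\in I}\notin c_0(I)\}$ is countable for every closed separable $H\subset K$, then $(F_i)_{i\in I}$ is of type $c_0\ell_1$ over $Q$. Let $L$ be an uncountable compact line and let $K=L^\omega$ be the set of all sequences in $L$, with the lexicographic order and its order topology. Then $K$ is a compact line and $K$ is not separably determined. More precisely, for a finite sequence $\epsilon$ in $L$ let $C_\epsilon\subset K$ be the set of sequences extending $\epsilon$ and let $F_\epsilon$ be the characteristic function of $C_\epsilon\setminus\{\max C_\epsilon\}$. For every $R\subset L\setminus\{\min L,\max L\}$ with $|R|=\omega_1$, the family $(F_\epsilon)_{\epsilon\in R^{<\omega}}$, indexed by the finite sequences in $R$, is weak\*-null in $\mathrm{NBV}(K)$, and there is a set $Q\subset R^\omega$ such that $Q\cap(H\setminus H^+)$ is countable for every closed separable $H\subset K$, while $(F_\epsilon)_{\epsilon\in R^{<\omega}}$ is not of type $c_0\ell_1$ over $Q$. -/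

import Mathlib

open Set Filter Topology MeasureTheory
open scoped Cardinal

noncomputable section

namespace CompactLine

/-- Points of `H` that are right isolated in `H` for the order induced by the ambient line: either
`t = max H`, or `t` has an immediate successor in `H`. -/
def rightIsolated {K : Type*} [LinearOrder K] (H : Set K) : Set K :=
  {t | t ∈ H ∧ (IsGreatest H t ∨ ∃ s ∈ H, t < s ∧ ∀ u ∈ H, ¬ (t < u ∧ u < s))}

/-- `(x i)` belongs to `c₀(I)`: for each neighbourhood of `0`, all but finitely many terms are
in it. -/
def InC0 {I : Type*} (x : I → ℝ) : Prop :=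
  Tendsto x cofinite (𝓝 0)

/-- A family of real-valued maps on a set `X` is of type `c₀ℓ₁`: `F i t = a i t + b i t`, where
`(a i t)` is in `c₀(I)` for every `t`, and the sums over `t` of `|b i t|` are bounded in `i`. -/
def IsC0L1 {I X : Type*} (F : I → X → ℝ) : Prop :=
  ∃ a b : I → X → ℝ, (∀ i t, F i t = a i t + b i t) ∧
    (∀ t, InC0 (fun i => a i t)) ∧
    (⨆ i, ∑' t, ENNReal.ofReal |b i t|) < ⊤

/-- The family is of type `c₀ℓ₁` over the subset `Q`. -/
def IsC0L1Over {I X : Type*} (F : I → X → ℝ) (Q : Set X) : Prop :=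
  IsC0L1 (fun i (t : Q) => F i t)

/-- The space `NBV(K)` of right-continuous maps of bounded variation. -/
def NBV (K : Type*) [LinearOrder K] [TopologicalSpace K] : Set (K → ℝ) :=
  {F | BoundedVariationOn F univ ∧ ∀ t, ContinuousWithinAt F (Ici t) t}

/-- The regular finite signed Borel measure `μ` corresponds to the map `F`, that is,
`F t = μ [min K, t]` for all `t`. -/
def Represents {K : Type*} [LinearOrder K] [TopologicalSpace K] [MeasurableSpace K]
    (μ : SignedMeasure K) (F : K → ℝ) : Prop :=
  μ.totalVariation.Regular ∧ ∀ t, F t = μ (Iic t)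

/-- A family in `NBV(K)` is weak*-null if the corresponding family of regular signed measures,
seen as functionals on `C(K)`, converges weak* to `0` along the cofinite filter. -/
def IsWeakStarNull {K : Type*} [LinearOrder K] [TopologicalSpace K] [OrderTopology K]
    [MeasurableSpace K] [BorelSpace K] {I : Type*} (F : I → K → ℝ) : Prop :=
  (∀ i, F i ∈ NBV K) ∧
    ∃ μ : I → SignedMeasure K, (∀ i, Represents (μ i) (F i)) ∧
      ∀ f : C(K, ℝ), InC0 (fun i => ∫ᵛ x, f x ∂<•(μ i))

/-- `K` (a compact line) is separably determined: for every weak*-null family `F` in `NBV(K)` and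
every subset `Q`, if `{t ∈ Q ∩ (H \ H⁺) : (F i t) ∉ c₀(I)}` is countable for all closed separable
`H`, then `F` is of type `c₀ℓ₁` over `Q`. -/
def SeparablyDetermined.{u} (K : Type u) [LinearOrder K] [TopologicalSpace K] [OrderTopology K]
    [MeasurableSpace K] [BorelSpace K] : Prop :=
  ∀ (I : Type u) (F : I → K → ℝ), IsWeakStarNull F → ∀ Q : Set K,
    (∀ H : Set K, IsClosed H → TopologicalSpace.SeparableSpace H →
      {t | t ∈ Q ∩ (H \ rightIsolated H) ∧ ¬ InC0 (fun i => F i t)}.Countable) →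
    IsC0L1Over F Q

/-- The power `L^ω` with the lexicographic order. -/
abbrev LexPower (L : Type*) := Lex (ℕ → L)

/-- `L^ω` carries the order topology of the lexicographic order. -/
instance {L : Type*} [LinearOrder L] : TopologicalSpace (LexPower L) := Preorder.topology _

instance {L : Type*} [LinearOrder L] : OrderTopology (LexPower L) := ⟨rfl⟩

instance {L : Type*} [LinearOrder L] : MeasurableSpace (LexPower L) := borel _

instance {L : Type*} [LinearOrder L] : BorelSpace (LexPower L) := ⟨rfl⟩

/-- `C_ε`: the sequences that extend the finite sequence `ε`. -/
def cylinder {L : Type*} (ε : List L) : Set (LexPower L) :=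
  {t | ∀ (i : ℕ) (h : i < ε.length), ofLex t i = ε[i]}

/-- `F_ε`: the characteristic function of `C_ε` without its maximum. -/
def cylinderFun {L : Type*} [LinearOrder L] (ε : List L) : LexPower L → ℝ :=
  (cylinder ε \ {t | IsGreatest (cylinder ε) t}).indicator 1

end CompactLine

end

/-! The function `F_ε` represents the Dirac mass at `min C_ε` minus the one at `max C_ε`, so
weak*-nullity says that a continuous function varies little between the ends of all but finitely
many cylinders. Suppose that along a nonprincipal ultrafilter these ends had distinct limits. Then
almost all the cylinders would share a point `z`, hence come from initial segments of `z`, and such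
cylinders shrink to `z` (`tendsto_sub_pad_cofinite`).

For `Q`, well-order `R` in type `ω₁` and let each non-least `a` contribute a sequence enumerating
its predecessors. A point of `Q` in `H \ H⁺` is a limit from the right of a countable dense subset
of `H`, so its terms are coordinates of that subset; this bounds `a` and leaves countably many
points. If the family were of type `c₀ℓ₁` over `Q`, then far enough along each branch `t` the `ℓ₁`
part would be at least `1/2`, so only finitely many branches could be past their threshold at a
given node (`exists_rank_of_isC0L1`). A closing-off argument in `ω₁` refutes this
(`exists_family_not_sigma_discrete`). -/

noncomputable section

namespace CompactLine

/-! ### Closing off in `ω₁`. -/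

section Combinatorics

/-- On a set of cardinality `ℵ₁`, there is a family of sequences such that only countably many of
them take their values in a given countable set, and which is not a countable union of sets `T m`
such that finitely many members of `T m` go through each node of length at least `m`. -/
theorem exists_family_not_sigma_discrete {W : Type*} (hW : #W = ℵ₁) :
    ∃ T : Set (LexPower W),
      (∀ S : Set W, S.Countable → {t ∈ T | ∀ n, ofLex t n ∈ S}.Countable) ∧
      ∀ N : LexPower W → ℕ, ∃ ε : List W,
        {t ∈ T | N t ≤ ε.length ∧ t ∈ cylinder ε}.Infinite := by
  obtain ⟨_, _, hord⟩ := Cardinal.exists_ord_eq_type_lt W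
  have hIio (a : W) : (Iio a).Countable := by
    rw [← Cardinal.le_aleph0_iff_set_countable, ← Cardinal.lt_aleph_one_iff, ← hW]
    exact Cardinal.mk_Iio_lt a hord
  have hIic (a : W) : (Iic a).Countable := by
    rw [← Iio_insert]
    exact (hIio a).insert a
  have hunc : ¬ (univ : Set W).Countable := by
    rw [← Cardinal.le_aleph0_iff_set_countable, ← Cardinal.lt_aleph_one_iff, Cardinal.mk_univ, hW]
    exact lt_irrefl _
  have hne (A : Set W) (hA : A.Countable) : Aᶜ.Nonempty := by
    rw [nonempty_compl]
    rintro rfl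
    exact hunc hA
  have henum (a : W) : ∃ t : ℕ → W, (Iio a).Nonempty → range t = Iio a := by
    by_cases h : (Iio a).Nonempty
    · obtain ⟨t, ht⟩ := (hIio a).exists_eq_range h
      exact ⟨t, fun _ => ht.symm⟩
    · exact ⟨fun _ => a, fun h' => absurd h' h⟩
  choose e he using henum
  set Λ : Set W := {a | (Iio a).Nonempty} with hΛ
  have hinj : InjOn (fun a => (toLex (e a) : LexPower W)) Λ := by
    intro a ha b hb hab
    have : e a = e b := hab
    have h : Iio a = Iio b := by rw [← he a ha, ← he b hb, this]
    exact Iio_injective h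
  refine ⟨(fun a => (toLex (e a) : LexPower W)) '' Λ, fun S hS => ?_, fun N => ?_⟩
  -- An index `a` above some `b ∉ S` is excluded, because `b` is then a term of `e a`.
  · obtain ⟨b, hb⟩ := hne S hS
    refine ((hIic b).image fun a => (toLex (e a) : LexPower W)).mono ?_
    rintro _ ⟨⟨a, ha, rfl⟩, hat⟩
    refine ⟨a, ?_, rfl⟩
    by_contra hlt
    have hb' : b ∈ range (e a) := by
      rw [he a ha]
      exact not_le.1 hlt
    obtain ⟨n, rfl⟩ := hb'
    exact hb (hat n)
  · by_contra! hfin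
    set G : List W → Set W := fun ε =>
      {a ∈ Λ | N (toLex (e a)) ≤ ε.length ∧ (toLex (e a) : LexPower W) ∈ cylinder ε} with hG
    have hGc (ε : List W) : (G ε).Countable := by
      refine Set.Finite.countable (Set.Finite.of_finite_image (f := fun a =>
        (toLex (e a) : LexPower W)) ((hfin ε).subset ?_) (hinj.mono fun a ha => ha.1))
      rintro _ ⟨a, ha, rfl⟩
      exact ⟨⟨a, ha.1, rfl⟩, ha.2⟩
    obtain ⟨w, -⟩ := hne ∅ countable_empty
    -- Iterating `step` gives a countable initial segment `Iio d` containing `G ε` for every list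
    -- `ε` in it. But `e d` takes its values in `Iio d`, so its initial segment of length `N (e d)`
    -- is such a list and puts `d` in `Iio d`.
    let step : Set W → Set W := fun A =>
      A ∪ (⋃ a ∈ A, Iio a) ∪ ⋃ ε ∈ {l : List W | ∀ x ∈ l, x ∈ A}, G ε
    have hlists {A : Set W} (hA : A.Countable) : {l : List W | ∀ x ∈ l, x ∈ A}.Countable := by
      have := hA.to_subtype
      rw [← Set.range_list_map_coe]
      exact countable_range _
    have hstepc {A : Set W} (hA : A.Countable) : (step A).Countable :=
      (hA.union (hA.biUnion fun a _ => hIio a)).union ((hlists hA).biUnion fun ε _ => hGc ε)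
    set A : ℕ → Set W := fun k => step^[k] {w} with hAdef
    have hsucc (k : ℕ) : A (k + 1) = step (A k) := Function.iterate_succ_apply' _ _ _
    have hAc (k : ℕ) : (A k).Countable := by
      induction k with
      | zero => exact countable_singleton w
      | succ k ih => rw [hsucc]; exact hstepc ih
    have hmono : Monotone A := monotone_nat_of_le_succ fun k => by
      rw [hsucc]
      exact fun a ha => Or.inl (Or.inl ha)
    have hlist (l : List W) (hl : ∀ x ∈ l, x ∈ ⋃ k, A k) : ∃ k, ∀ x ∈ l, x ∈ A k := by
      induction l with
      | nil => exact ⟨0, by simp⟩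
      | cons x l ih =>
        obtain ⟨k, hk⟩ := ih fun y hy => hl y (List.mem_cons_of_mem _ hy)
        obtain ⟨j, hj⟩ := mem_iUnion.1 (hl x List.mem_cons_self)
        refine ⟨max j k, fun y hy => ?_⟩
        rcases List.mem_cons.1 hy with rfl | hy
        · exact hmono (le_max_left _ _) hj
        · exact hmono (le_max_right _ _) (hk y hy)
    have hne' := hne (⋃ k, A k) (countable_iUnion hAc)
    obtain ⟨d, hd, hmin⟩ := WellFounded.has_min (wellFounded_lt (α := W)) _ hne'
    have hIioA : Iio d ⊆ ⋃ k, A k := fun a ha => by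
      by_contra h
      exact hmin a h ha
    have hAIio : ⋃ k, A k ⊆ Iio d := fun a ha => by
      by_contra h
      rcases (not_lt.1 h).eq_or_lt with rfl | hlt
      · exact hd ha
      · obtain ⟨k, hk⟩ := mem_iUnion.1 ha
        refine hd (mem_iUnion.2 ⟨k + 1, ?_⟩)
        rw [hsucc]
        exact Or.inl (Or.inr (mem_biUnion hk hlt))
    have hdΛ : d ∈ Λ := ⟨w, hAIio (mem_iUnion.2 ⟨0, rfl⟩)⟩
    set ε : List W := List.ofFn fun i : Fin (N (toLex (e d))) => e d i with hε
    obtain ⟨k, hk⟩ := hlist ε fun x hx => by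
      obtain ⟨i, rfl⟩ := (List.mem_ofFn' _ _).1 hx
      refine hIioA ?_
      rw [← he d hdΛ]
      exact mem_range_self _
    refine hd (mem_iUnion.2 ⟨k + 1, ?_⟩)
    rw [hsucc]
    refine Or.inr (mem_biUnion (show ε ∈ _ from hk) ⟨hdΛ, by simp [hε], fun i hi => ?_⟩)
    simp [hε]

end Combinatorics

/-! ### Suprema, compactness and one-sided accumulation. -/

section Order

/-- A linearly ordered space in which every subset has a supremum is compact. -/
theorem compactSpace_of_forall_exists_isLUB {X : Type*} [LinearOrder X] [TopologicalSpace X]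
    [OrderTopology X] (h : ∀ S : Set X, ∃ a, IsLUB S a) : CompactSpace X := by
  refine ⟨isCompact_iff_ultrafilter_le_nhds.2 fun f _ => ?_⟩
  obtain ⟨x, hx⟩ := h {y | Ici y ∈ f}
  refine ⟨x, mem_univ x, ?_⟩
  rw [nhds_eq_order]
  refine le_inf (le_iInf₂ fun b hb => ?_) (le_iInf₂ fun b hb => ?_)
  · obtain ⟨y, hy, hby, -⟩ := hx.exists_between hb
    exact le_principal_iff.2 (mem_of_superset hy fun z hz => lt_of_lt_of_le hby hz)
  · have : Ici b ∉ f := fun h' => not_le_of_gt (show x < b from hb) (hx.1 h')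
    rw [← Ultrafilter.compl_mem_iff_notMem, compl_Ici] at this
    exact le_principal_iff.2 this

theorem exists_isLUB_of_compactSpace {X : Type*} [LinearOrder X] [TopologicalSpace X]
    [OrderTopology X] [CompactSpace X] [Nonempty X] (S : Set X) : ∃ a, IsLUB S a := by
  rcases S.eq_empty_or_nonempty with rfl | hS
  · obtain ⟨a, ha⟩ := isCompact_univ.exists_isLeast (univ_nonempty (α := X))
    exact ⟨a, isLUB_empty_iff.2 fun b => ha.2 (mem_univ b)⟩
  · obtain ⟨a, -, ha⟩ := isClosed_closure.isCompact.exists_isLUB hS.closure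
    exact ⟨a, (isLUB_congr (upperBounds_closure S)).1 ha⟩

theorem LexPower.lt_iff {L : Type*} [LinearOrder L] {s t : LexPower L} :
    s < t ↔ ∃ i, (∀ j < i, ofLex s j = ofLex t j) ∧ ofLex s i < ofLex t i :=
  Iff.rfl

/-- Coordinatewise suprema along the tree of partial maximizers give suprema in `L^ω`. -/
theorem LexPower.exists_isLUB {L : Type*} [LinearOrder L] (h : ∀ S : Set L, ∃ a, IsLUB S a)
    (S : Set (LexPower L)) : ∃ a, IsLUB S a := by
  choose σ hσ using h
  -- `V n` is the set of members of `S` that agree with `s` below `n`. Once a coordinate supremum is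
  -- not attained, `V` is empty and `s` continues with `σ ∅`, the least element.
  let V : ℕ → Set (LexPower L) := fun n =>
    n.rec S fun k A => {t ∈ A | ofLex t k = σ ((fun t : LexPower L => ofLex t k) '' A)}
  let s : LexPower L := toLex fun n => σ ((fun t : LexPower L => ofLex t n) '' V n)
  have hV (n : ℕ) (t : LexPower L) :
      t ∈ V n ↔ t ∈ S ∧ ∀ j < n, ofLex t j = ofLex s j := by
    induction n with
    | zero => exact ⟨fun ht => ⟨ht, by simp⟩, fun ht => ht.1⟩
    | succ n ih =>
      change t ∈ V n ∧ ofLex t n = ofLex s n ↔ _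
      rw [ih, and_assoc, Nat.forall_lt_succ_right]
  refine ⟨s, fun t ht => ?_, fun u hu => ?_⟩
  · by_contra hlt
    obtain ⟨k, hk, hlt⟩ := LexPower.lt_iff.1 (not_le.1 hlt)
    exact not_le_of_gt hlt ((hσ _).1 ⟨t, (hV k t).2 ⟨ht, fun j hj => (hk j hj).symm⟩, rfl⟩)
  · by_contra hlt
    obtain ⟨k, hk, hlt⟩ := LexPower.lt_iff.1 (not_le.1 hlt)
    obtain ⟨_, ⟨t, ht, rfl⟩, hut, -⟩ := (hσ ((fun t : LexPower L => ofLex t k) '' V k)).exists_between hlt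
    obtain ⟨htS, htk⟩ := (hV k t).1 ht
    exact not_le_of_gt (LexPower.lt_iff.2 ⟨k, fun j hj => (hk j hj).trans (htk j hj).symm, hut⟩)
      (hu htS)

/-- A dense subset of a closed set `H` in a compact line accumulates from the right at the points
of `H` that are not right isolated. -/
theorem exists_mem_Ioo_of_notMem_rightIsolated {K : Type*} [LinearOrder K] [TopologicalSpace K]
    [OrderTopology K] [CompactSpace K] {H : Set K} (hH : IsClosed H) {D : Set H} (hD : Dense D)
    {t s : K} (ht : t ∈ H \ rightIsolated H) (hts : t < s) : ∃ d ∈ D, (d : K) ∈ Ioo t s := by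
  obtain ⟨htH, hti⟩ := ht
  have hne : ∃ h ∈ H, h ∈ Ioo t s := by
    by_contra! hemp
    refine hti ⟨htH, ?_⟩
    by_cases hg : IsGreatest H t
    · exact Or.inl hg
    · obtain ⟨h, hh, hth⟩ : ∃ h ∈ H, t < h := by
        by_contra! hle
        exact hg ⟨htH, hle⟩
      have hsh : s ≤ h := not_lt.1 fun hhs => hemp h hh ⟨hth, hhs⟩
      -- As `H` misses `Ioo t s`, this least element is the immediate successor of `t` in `H`.
      obtain ⟨m, hm, hleast⟩ := (hH.inter isClosed_Ici).isCompact.exists_isLeast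
        (⟨h, hh, hsh⟩ : (H ∩ Ici s).Nonempty)
      refine Or.inr ⟨m, hm.1, hts.trans_le hm.2, fun u hu htu => ?_⟩
      rcases lt_or_ge u s with hus | hsu
      · exact hemp u hu ⟨htu.1, hus⟩
      · exact not_le_of_gt htu.2 (hleast ⟨hu, hsu⟩)
  obtain ⟨h, hh, hhts⟩ := hne
  obtain ⟨d, hd, hdD⟩ := hD.inter_open_nonempty _ (isOpen_Ioo.preimage continuous_subtype_val)
    ⟨⟨h, hh⟩, hhts⟩
  exact ⟨d, hdD, hd⟩

end Order

/-! ### Cylinders as intervals, and their convergence. -/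

section Cylinder

variable {L : Type*}

/-- The extension of the finite sequence `ε` by the constant value `c`. -/
def pad (ε : List L) (c : L) : LexPower L :=
  toLex fun n => ε.getD n c

/-- The list of the first `n` terms of `t`. -/
def initialSegment (t : LexPower L) (n : ℕ) : List L :=
  List.ofFn fun i : Fin n => ofLex t i

@[simp] theorem length_initialSegment (t : LexPower L) (n : ℕ) :
    (initialSegment t n).length = n := by
  simp [initialSegment]

theorem mem_cylinder_initialSegment {s t : LexPower L} {n : ℕ} :
    s ∈ cylinder (initialSegment t n) ↔ ∀ i < n, ofLex s i = ofLex t i := by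
  simp [cylinder, initialSegment]

theorem eq_initialSegment_of_mem_cylinder {t : LexPower L} {ε : List L} (h : t ∈ cylinder ε) :
    ε = initialSegment t ε.length := by
  refine List.ext_getElem (by simp) fun i hi _ => ?_
  simpa [initialSegment] using (h i hi).symm

theorem initialSegment_injective (t : LexPower L) : Function.Injective (initialSegment t) :=
  fun m n h => by simpa using congrArg List.length h

theorem pad_mem_cylinder (ε : List L) (c : L) : pad ε c ∈ cylinder ε := fun i hi => by
  simp [pad, hi]

variable [LinearOrder L]

theorem ordConnected_cylinder (ε : List L) : (cylinder ε).OrdConnected := by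
  refine ⟨fun x hx y hy t ht i => ?_⟩
  induction i using Nat.strong_induction_on with
  | _ i ih =>
    intro hi
    have h₁ : ofLex x i ≤ ofLex t i := Pi.apply_le_of_toLex ht.1 fun j hj => by
      exact (hx j (hj.trans hi)).trans (ih j hj (hj.trans hi)).symm
    have h₂ : ofLex t i ≤ ofLex y i := Pi.apply_le_of_toLex ht.2 fun j hj => by
      exact (ih j hj (hj.trans hi)).trans (hy j (hj.trans hi)).symm
    rw [hx i hi] at h₁
    rw [hy i hi] at h₂
    exact le_antisymm h₂ h₁

theorem pad_le_of_mem_cylinder {ε : List L} {b : L} (hb : IsBot b) {t : LexPower L}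
    (ht : t ∈ cylinder ε) : pad ε b ≤ t := by
  refine Pi.toLex_monotone (a := fun n => ε.getD n b) (b := ofLex t) fun n => ?_
  by_cases hn : n < ε.length
  · simp [hn, ht n hn]
  · simpa [not_lt.1 hn] using hb _

theorem le_pad_of_mem_cylinder {ε : List L} {c : L} (hc : IsTop c) {t : LexPower L}
    (ht : t ∈ cylinder ε) : t ≤ pad ε c := by
  refine Pi.toLex_monotone (a := ofLex t) (b := fun n => ε.getD n c) fun n => ?_
  by_cases hn : n < ε.length
  · simp [hn, ht n hn]
  · simpa [not_lt.1 hn] using hc _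

theorem cylinder_eq_Icc {b c : L} (hb : IsBot b) (hc : IsTop c) (ε : List L) :
    cylinder ε = Icc (pad ε b) (pad ε c) :=
  Subset.antisymm (fun _ ht => ⟨pad_le_of_mem_cylinder hb ht, le_pad_of_mem_cylinder hc ht⟩)
    ((ordConnected_cylinder ε).out (pad_mem_cylinder ε b) (pad_mem_cylinder ε c))

theorem pad_le_pad {b c : L} (hb : IsBot b) (ε : List L) : pad ε b ≤ pad ε c :=
  pad_le_of_mem_cylinder hb (pad_mem_cylinder ε c)

theorem cylinderFun_eq_indicator_Ico {b c : L} (hb : IsBot b) (hc : IsTop c) (ε : List L) :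
    cylinderFun ε = (Ico (pad ε b) (pad ε c)).indicator 1 := by
  have h : {t | IsGreatest (cylinder ε) t} = {pad ε c} := by
    have hg : IsGreatest (cylinder ε) (pad ε c) :=
      ⟨pad_mem_cylinder ε c, fun t ht => le_pad_of_mem_cylinder hc ht⟩
    ext t
    exact ⟨fun ht => ht.unique hg, fun ht => ht ▸ hg⟩
  rw [cylinderFun, h, cylinder_eq_Icc hb hc, Icc_sdiff_right]

theorem cylinderFun_eq_one {c : L} (hc : IsTop c) {ε : List L} {t : LexPower L}
    (ht : t ∈ cylinder ε) (htc : ∀ n, ofLex t n ≠ c) : cylinderFun ε t = 1 := by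
  refine indicator_of_mem (s := cylinder ε \ {t | IsGreatest (cylinder ε) t})
    ⟨ht, fun (hg : IsGreatest (cylinder ε) t) => ?_⟩ _
  have : t = pad ε c := le_antisymm (le_pad_of_mem_cylinder hc ht) (hg.2 (pad_mem_cylinder ε c))
  refine htc ε.length ?_
  rw [this]
  simp [pad]

/-- Points of the cylinders around `z` converge to `z`. -/
theorem tendsto_of_mem_cylinder (z : LexPower L) {s : List L → LexPower L}
    (hs : ∀ ε, s ε ∈ cylinder ε) :
    Tendsto s (cofinite ⊓ 𝓟 {ε | z ∈ cylinder ε}) (𝓝 z) := by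
  have key (k : ℕ) : ∀ᶠ ε in cofinite ⊓ 𝓟 {ε | z ∈ cylinder ε},
      ∀ j ≤ k, ofLex (s ε) j = ofLex z j := by
    rw [eventually_inf_principal]
    -- The exceptions are initial segments of `z` of length at most `k`.
    refine ((finite_Iic k).image (initialSegment z)).subset fun ε hε => ?_
    simp only [mem_compl_iff, mem_ofPred_eq, Classical.not_imp] at hε
    obtain ⟨hz, hne⟩ := hε
    refine ⟨ε.length, ?_, (eq_initialSegment_of_mem_cylinder hz).symm⟩
    by_contra hlt
    refine hne fun j hj => ?_
    have hj' : j < ε.length := lt_of_le_of_lt hj (not_le.1 hlt)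
    rw [hs ε j hj', hz j hj']
  rw [tendsto_order]
  refine ⟨fun w hw => ?_, fun w hw => ?_⟩
  · obtain ⟨k, hk, hlt⟩ := LexPower.lt_iff.1 hw
    filter_upwards [key k] with ε hε
    exact LexPower.lt_iff.2 ⟨k, fun j hj => (hk j hj).trans (hε j hj.le).symm,
      (hε k le_rfl).symm ▸ hlt⟩
  · obtain ⟨k, hk, hlt⟩ := LexPower.lt_iff.1 hw
    filter_upwards [key k] with ε hε
    exact LexPower.lt_iff.2 ⟨k, fun j hj => (hε j hj.le).trans (hk j hj),
      (hε k le_rfl).symm ▸ hlt⟩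

/-- A continuous function has small increments between the endpoints of all but finitely many
cylinders. -/
theorem tendsto_sub_pad_cofinite [CompactSpace (LexPower L)] {b c : L} (hb : IsBot b)
    (f : C(LexPower L, ℝ)) :
    Tendsto (fun ε => f (pad ε b) - f (pad ε c)) cofinite (𝓝 0) := by
  rw [tendsto_iff_ultrafilter]
  intro g hg
  obtain ⟨x, -, hx⟩ := isCompact_iff_ultrafilter_le_nhds.1 (isCompact_univ (X := LexPower L))
    (g.map fun ε => pad ε b) (by simp)
  obtain ⟨y, -, hy⟩ := isCompact_iff_ultrafilter_le_nhds.1 (isCompact_univ (X := LexPower L))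
    (g.map fun ε => pad ε c) (by simp)
  have hx' : Tendsto (fun ε => pad ε b) g (𝓝 x) := hx
  have hy' : Tendsto (fun ε => pad ε c) g (𝓝 y) := hy
  have hxy : x = y := by
    refine (le_of_tendsto_of_tendsto' hx' hy' fun ε => pad_le_pad hb ε).eq_or_lt.resolve_right
      fun hlt => ?_
    obtain ⟨z, hz⟩ : ∃ z, ∀ᶠ ε in (g : Filter (List L)), z ∈ Icc (pad ε b) (pad ε c) := by
      by_cases hz : ∃ z, x < z ∧ z < y
      · obtain ⟨z, hxz, hzy⟩ := hz
        refine ⟨z, ?_⟩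
        filter_upwards [hx'.eventually (gt_mem_nhds hxz), hy'.eventually (lt_mem_nhds hzy)]
          with ε h₁ h₂ using ⟨h₁.le, h₂.le⟩
      -- If `x < y` is a jump, a left end below `y` is at most `x`, so `x` itself is the common
      -- point.
      · push Not at hz
        refine ⟨x, ?_⟩
        filter_upwards [hx'.eventually (gt_mem_nhds hlt), hy'.eventually (lt_mem_nhds hlt)]
          with ε h₁ h₂
        exact ⟨not_lt.1 fun h => hz _ h h₁, h₂.le⟩
    have hz' : (g : Filter (List L)) ≤ cofinite ⊓ 𝓟 {ε | z ∈ cylinder ε} := by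
      refine le_inf hg (le_principal_iff.2 ?_)
      filter_upwards [hz] with ε hε
      exact (ordConnected_cylinder ε).out (pad_mem_cylinder ε b) (pad_mem_cylinder ε c) hε
    have h₁ := tendsto_nhds_unique hx'
      ((tendsto_of_mem_cylinder z fun ε => pad_mem_cylinder ε b).mono_left hz')
    have h₂ := tendsto_nhds_unique hy'
      ((tendsto_of_mem_cylinder z fun ε => pad_mem_cylinder ε c).mono_left hz')
    exact hlt.ne (h₁.trans h₂.symm)
  subst hxy
  simpa using ((f.continuous.tendsto x).comp hx').sub ((f.continuous.tendsto x).comp hy')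

end Cylinder

/-! ### Differences of Dirac masses and their distribution functions. -/

section Dirac

variable {K : Type*} [LinearOrder K]

theorem indicator_Ico_eq_sub {a b : K} (hab : a ≤ b) (t : K) :
    (Ico a b).indicator (1 : K → ℝ) t =
      (Ici a).indicator (1 : K → ℝ) t - (Ici b).indicator (1 : K → ℝ) t := by
  by_cases hb : b ≤ t
  · simp [indicator, hb, hab.trans hb, not_lt.2 hb]
  · simp [indicator, hb, not_le.1 hb]

/-- The indicator is bounded, increasing up to `a` and decreasing from `a` on. -/
theorem boundedVariationOn_indicator_Ico (a b : K) :
    BoundedVariationOn ((Ico a b).indicator (1 : K → ℝ)) univ := by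
  have hbound (t : K) : |(Ico a b).indicator (1 : K → ℝ) t| ≤ 1 := by
    by_cases h : t ∈ Ico a b <;> simp [h]
  have h₁ : BoundedVariationOn ((Ico a b).indicator (1 : K → ℝ)) (Iic a) := by
    refine MonotoneOn.boundedVariationOn (C := 1) (fun x hx y hy hxy => ?_) fun x _ => hbound x
    by_cases h : x ∈ Ico a b
    · have : x = y := le_antisymm hxy (le_trans hy h.1)
      rw [this]
    · rw [indicator_of_notMem h]
      exact indicator_nonneg (fun _ _ => zero_le_one) y
  have h₂ : BoundedVariationOn (-(Ico a b).indicator (1 : K → ℝ)) (Ici a) := by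
    refine MonotoneOn.boundedVariationOn (C := 1) (fun x hx y hy hxy => ?_)
      fun x _ => by simpa using hbound x
    by_cases h : y ∈ Ico a b
    · have : x ∈ Ico a b := ⟨hx, hxy.trans_lt h.2⟩
      simp [h, this]
    · simp only [Pi.neg_apply, indicator_of_notMem h, neg_zero, neg_nonpos]
      exact indicator_nonneg (fun _ _ => zero_le_one) x
  have h₃ : BoundedVariationOn ((Ico a b).indicator (1 : K → ℝ)) (Ici a) := by
    have := (LipschitzWith.id.neg (α := ℝ)).lipschitzOnWith.comp_boundedVariationOn
      (mapsTo_univ (-(Ico a b).indicator (1 : K → ℝ)) (Ici a)) h₂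
    rwa [show (-id) ∘ (-(Ico a b).indicator (1 : K → ℝ)) = (Ico a b).indicator 1 by
      ext x; simp] at this
  have := eVariationOn.union ((Ico a b).indicator (1 : K → ℝ)) (isGreatest_Iic (a := a))
    isLeast_Ici
  rw [Iic_union_Ici] at this
  rw [BoundedVariationOn, this]
  exact ENNReal.add_ne_top.2 ⟨h₁, h₃⟩

variable [TopologicalSpace K] [OrderTopology K]

theorem continuousWithinAt_indicator_Ici (a t : K) :
    ContinuousWithinAt ((Ici a).indicator (1 : K → ℝ)) (Ici t) t := by
  by_cases h : a ≤ t
  · refine (continuousWithinAt_const (b := (1 : ℝ))).congr (fun y hy => ?_) ?_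
    · simp [h.trans hy]
    · simp [h]
  · have : (Ici a).indicator (1 : K → ℝ) =ᶠ[𝓝 t] fun _ => 0 := by
      filter_upwards [gt_mem_nhds (not_le.1 h)] with y hy
      simp [hy]
    exact (continuousAt_const.congr this.symm).continuousWithinAt

theorem indicator_Ico_mem_NBV {a b : K} (hab : a ≤ b) :
    (Ico a b).indicator (1 : K → ℝ) ∈ NBV K := by
  refine ⟨boundedVariationOn_indicator_Ico a b, fun t => ?_⟩
  rw [funext (indicator_Ico_eq_sub hab)]
  exact (continuousWithinAt_indicator_Ici a t).sub (continuousWithinAt_indicator_Ici b t)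

/-- A set meets the finite support in a finite, hence compact, set of the same measure. -/
theorem regular_of_finite_support {X : Type*} [TopologicalSpace X] [T2Space X]
    [MeasurableSpace X] [BorelSpace X] (ν : Measure X) [IsFiniteMeasure ν] {s : Set X}
    (hs : s.Finite) (hν : ν sᶜ = 0) : ν.Regular := by
  have : ν.InnerRegular := ⟨fun U _ r hr => ⟨U ∩ s, inter_subset_left,
    (hs.subset inter_subset_right).isCompact, by rwa [measure_inter_conull hν]⟩⟩
  infer_instance

variable [MeasurableSpace K] [BorelSpace K]

/-- The signed measure `δ_a - δ_b`. -/
def diracSub (a b : K) : SignedMeasure K :=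
  VectorMeasure.dirac a (1 : ℝ) - VectorMeasure.dirac b (1 : ℝ)

theorem represents_diracSub {a b : K} (hab : a ≤ b) :
    Represents (diracSub a b) ((Ico a b).indicator 1) := by
  constructor
  · rw [SignedMeasure.totalVariation_eq_variation]
    have hle : (diracSub a b).variation ≤ Measure.dirac a + Measure.dirac b := by
      refine VectorMeasure.variation_sub_le.trans ?_
      simp
    have : IsFiniteMeasure (diracSub a b).variation := isFiniteMeasure_of_le _ hle
    refine regular_of_finite_support _ (toFinite {a, b}) (le_antisymm ((hle _).trans ?_) zero_le)
    simp
  · intro t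
    have h (x : K) : (VectorMeasure.dirac x (1 : ℝ)) (Iic t) =
        (Ici x).indicator (1 : K → ℝ) t := by
      by_cases hx : x ≤ t
      · rw [VectorMeasure.dirac_apply_of_mem measurableSet_Iic hx]
        simp [hx]
      · rw [VectorMeasure.dirac_apply_of_notMem (show x ∉ Iic t from hx)]
        simp [hx]
    rw [indicator_Ico_eq_sub hab, diracSub, sub_apply, h, h]

theorem integral_diracSub [CompactSpace K] (a b : K) (f : C(K, ℝ)) :
    ∫ᵛ x, f x ∂<•(diracSub a b) = f a - f b := by
  have hint (x : K) : (VectorMeasure.dirac x (1 : ℝ)).Integrable f := by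
    rw [VectorMeasure.Integrable, VectorMeasure.variation_dirac]
    simpa using f.continuous.integrable_of_hasCompactSupport (μ := Measure.dirac x)
      (HasCompactSupport.of_compactSpace _)
  rw [diracSub, VectorMeasure.integral_sub_vectorMeasure (hint a) (hint b)]
  simp

theorem isWeakStarNull_cylinderFun {L : Type*} [LinearOrder L] [CompactSpace (LexPower L)]
    {b c : L} (hb : IsBot b) (hc : IsTop c) {I : Type*} {ι : I → List L}
    (hι : Function.Injective ι) : IsWeakStarNull fun i => cylinderFun (ι i) := by
  refine ⟨fun i => ?_, fun i => diracSub (pad (ι i) b) (pad (ι i) c), fun i => ?_, fun f => ?_⟩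
  · simpa only [cylinderFun_eq_indicator_Ico hb hc] using indicator_Ico_mem_NBV (pad_le_pad hb _)
  · simpa only [cylinderFun_eq_indicator_Ico hb hc] using represents_diracSub (pad_le_pad hb _)
  · simp only [integral_diracSub]
    exact (tendsto_sub_pad_cofinite hb f).comp hι.tendsto_cofinite

end Dirac

/-! ### The set `Q` and the failure of type `c₀ℓ₁`. -/

/-- If the functions `F ε` take the value `1` on the `t ∈ Q` through `ε`, and `F` is of type `c₀ℓ₁`
over `Q`, then `Q` decomposes into countably many uniformly locally finite pieces. -/
theorem exists_rank_of_isC0L1 {W X : Type*} {F : List W → X → ℝ} (hF : IsC0L1 F)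
    (τ : X → LexPower W) (h1 : ∀ ε x, τ x ∈ cylinder ε → F ε x = 1) :
    ∃ N : X → ℕ, ∀ ε : List W, {x | N x ≤ ε.length ∧ τ x ∈ cylinder ε}.Finite := by
  obtain ⟨a, b, hab, ha, hb⟩ := hF
  have hN (x : X) : ∃ N, ∀ n ≥ N, a (initialSegment (τ x) n) x < 1 / 2 := by
    have h := (ha x).comp (initialSegment_injective (τ x)).tendsto_cofinite
    rw [Nat.cofinite_eq_atTop] at h
    exact eventually_atTop.1 (h.eventually (gt_mem_nhds (by norm_num)))
  choose N hN using hN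
  refine ⟨N, fun ε => ?_⟩
  have hsum : ∑' x, ENNReal.ofReal |b ε x| ≠ ⊤ :=
    ((le_iSup (fun ε => ∑' x, ENNReal.ofReal |b ε x|) ε).trans_lt hb).ne
  refine (ENNReal.finite_const_le_of_tsum_ne_top hsum
    (ε := ENNReal.ofReal (1 / 2)) (by simp)).subset fun x hx => ENNReal.ofReal_le_ofReal ?_
  have h := hN x ε.length hx.1
  rw [← eq_initialSegment_of_mem_cylinder hx.2] at h
  have h' := hab ε x
  rw [h1 ε x hx.2] at h'
  exact le_trans (by linarith) (le_abs_self _)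

theorem exists_not_isC0L1Over {L : Type*} [LinearOrder L] [CompactSpace (LexPower L)] {c : L}
    (hc : IsTop c) (R : Set L) (hR : ∀ r ∈ R, r ≠ c) (hcard : #R = ℵ₁) :
    ∃ Q : Set (LexPower L), (∀ t ∈ Q, ∀ n : ℕ, ofLex t n ∈ R) ∧
      (∀ H : Set (LexPower L), IsClosed H → TopologicalSpace.SeparableSpace H →
        (Q ∩ (H \ rightIsolated H)).Countable) ∧
      ¬ IsC0L1Over (fun ε : List R => cylinderFun (ε.map Subtype.val)) Q := by
  obtain ⟨T, hT, hTinf⟩ := exists_family_not_sigma_discrete hcard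
  let φ : LexPower R → LexPower L := fun t => toLex fun n => (ofLex t n : L)
  have hφ : Function.Injective φ := fun s t h =>
    funext fun n => Subtype.ext (congrFun (h : (fun n => (ofLex s n : L)) = _) n)
  have hφc (t : LexPower R) (ε : List R) :
      φ t ∈ cylinder (ε.map Subtype.val) ↔ t ∈ cylinder ε := by
    simp [cylinder, φ, Subtype.ext_iff]
  have hφR (t : LexPower R) (n : ℕ) : ofLex (φ t) n ∈ R := (ofLex t n).2
  refine ⟨φ '' T, ?_, fun H hH hsep => ?_, fun hF => ?_⟩
  · rintro _ ⟨t, -, rfl⟩ n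
    exact hφR t n
  · obtain ⟨D, hDc, hD⟩ := TopologicalSpace.exists_countable_dense H
    let S : Set R := Subtype.val ⁻¹' ⋃ d ∈ D, range (ofLex (d : LexPower L))
    have hS : S.Countable :=
      (hDc.biUnion fun d _ => countable_range _).preimage Subtype.val_injective
    refine ((hT S hS).image φ).mono ?_
    rintro _ ⟨⟨t, htT, rfl⟩, htH⟩
    refine ⟨t, ⟨htT, fun n => ?_⟩, rfl⟩
    -- Points between these two share the first `n + 1` terms of `φ t`, so the term of index `n` is
    -- a coordinate of a point of `D`. Strictness holds since `φ t` never takes the value `c`.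
    have hlt : φ t < pad (initialSegment (φ t) (n + 1)) c := by
      refine LexPower.lt_iff.2 ⟨n + 1, fun j hj => ?_, ?_⟩
      · exact (mem_cylinder_initialSegment.1 (pad_mem_cylinder _ c) j hj).symm
      · have : ofLex (pad (initialSegment (φ t) (n + 1)) c) (n + 1) = c := by simp [pad]
        rw [this]
        exact (hc _).lt_of_ne (hR _ (hφR t _))
    obtain ⟨d, hdD, hd⟩ := exists_mem_Ioo_of_notMem_rightIsolated hH hD htH hlt
    have hdc := (ordConnected_cylinder _).out (mem_cylinder_initialSegment.2 fun _ _ => rfl)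
      (pad_mem_cylinder _ c) (Ioo_subset_Icc_self hd)
    exact mem_biUnion hdD ⟨n, mem_cylinder_initialSegment.1 hdc n n.lt_succ_self⟩
  · choose τ hτT hτ using fun x : φ '' T => x.2
    obtain ⟨N, hN⟩ := exists_rank_of_isC0L1 hF τ fun ε x hx =>
      cylinderFun_eq_one hc (hτ x ▸ (hφc _ ε).2 hx) fun n => by
        rw [← hτ x]
        exact hR _ (hφR _ n)
    classical
    obtain ⟨ε, hε⟩ := hTinf fun t => if ht : t ∈ T then N ⟨φ t, mem_image_of_mem φ ht⟩ else 0
    refine hε (((hN ε).image τ).subset ?_)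
    rintro t ⟨htT, hNt, ht⟩
    have hτt : τ ⟨φ t, mem_image_of_mem φ htT⟩ = t := hφ (hτ _)
    rw [dif_pos htT] at hNt
    exact ⟨_, ⟨hNt, by rwa [hτt]⟩, hτt⟩

end CompactLine

end

theorem theorem4p6 {L : Type*} [LinearOrder L] [TopologicalSpace L] [OrderTopology L]
    [CompactSpace L] [Uncountable L] :
    CompactSpace (CompactLine.LexPower L) ∧
    ¬ CompactLine.SeparablyDetermined (CompactLine.LexPower L) ∧
    ∀ R : Set L, (∀ r ∈ R, ¬ IsBot r ∧ ¬ IsTop r) → #R = ℵ₁ →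
      CompactLine.IsWeakStarNull
        (fun ε : List R => CompactLine.cylinderFun (ε.map Subtype.val)) ∧
      ∃ Q : Set (CompactLine.LexPower L), (∀ t ∈ Q, ∀ n : ℕ, ofLex t n ∈ R) ∧
        (∀ H : Set (CompactLine.LexPower L), IsClosed H → TopologicalSpace.SeparableSpace H →
          (Q ∩ (H \ CompactLine.rightIsolated H)).Countable) ∧
        ¬ CompactLine.IsC0L1Over
          (fun ε : List R => CompactLine.cylinderFun (ε.map Subtype.val)) Q := by
  have hcomp : CompactSpace (CompactLine.LexPower L) :=
    CompactLine.compactSpace_of_forall_exists_isLUB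
      (CompactLine.LexPower.exists_isLUB CompactLine.exists_isLUB_of_compactSpace)
  obtain ⟨b, hb⟩ := isCompact_univ.exists_isLeast (univ_nonempty (α := L))
  obtain ⟨c, hc⟩ := isCompact_univ.exists_isGreatest (univ_nonempty (α := L))
  have hb : IsBot b := fun x => hb.2 (mem_univ x)
  have hc : IsTop c := fun x => hc.2 (mem_univ x)
  have hnull (R : Set L) : CompactLine.IsWeakStarNull
      (fun ε : List R => CompactLine.cylinderFun (ε.map Subtype.val)) :=
    CompactLine.isWeakStarNull_cylinderFun hb hc
      (List.map_injective_iff.2 Subtype.val_injective)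
  refine ⟨hcomp, fun hsd => ?_, fun R hR hcard => ⟨hnull R,
    CompactLine.exists_not_isC0L1Over hc R (fun r hr h => (hR r hr).2 (h ▸ hc)) hcard⟩⟩
  have hunc : ℵ₁ ≤ #({b, c}ᶜ : Set L) := by
    rw [← not_lt, Cardinal.lt_aleph_one_iff, Cardinal.le_aleph0_iff_set_countable]
    intro h
    have := h.union (toFinite ({b, c} : Set L)).countable
    rw [compl_union_self] at this
    exact not_countable_univ this
  obtain ⟨R, hRsub, hcard⟩ := Cardinal.le_mk_iff_exists_subset.1 hunc
  obtain ⟨Q, -, hQ, hnot⟩ := CompactLine.exists_not_isC0L1Over hc R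
    (fun r hr h => hRsub hr (Or.inr h)) hcard
  exact hnot (hsd _ _ (hnull R) Q fun H hH hsep => (hQ H hH hsep).mono fun t ht => ht.1)
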